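/- **Theorem.** Let $X$ and $U$ be Banach spaces and let $A$ be the infinitesimal generator of a $C_0$-semigroup $(T_t)_{t\ge 0}$ of bounded linear operators on $X$. Let $(f_q)_{q\in\mathcal Q}$ be a family of maps $f_q:X\times U\to X$ that are Lipschitz continuous with a Lipschitz constant independent of $q$ and satisfy $f_q(0,0)=0$ for every $q\in\mathcal Q$. Let $\mathrm{PC}$ be the set of piecewise constant functions $\sigma:\mathbb R_+\to\mathcal Q$, i.e. those for which there are times $0=t_0<t_1<\cdots$ with $t_k\to\infty$ such that $\sigma$ is constant on each $[t_k,t_{k+1})$. For $x_0\in X$, $\sigma\in\mathrm{PC}$ and an input $u\in L^p(\mathbb R_+,U)$, $1\le p\le\infty$, let $\phi_u(\cdot,x_0,\sigma)$ denote the mild solution of $$\dot x(t)=Ax(t)+f_{\sigma(t)}(x(t),u(t)),\quad t\ge 0,\qquad x(0)=x_0,$$ that is, the continuous function $x:\mathbb R_+\to X$ with $$x(t)=T_tx_0+\int_0^tT_{t-s}f_{\sigma(s)}(x(s),u(s))\,ds\quad\text{for all } t\ge 0.$$ Assume that the unforced system ($u\equiv 0$) is uniformly globally exponentially stable: there are $M>0$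 and $\lambda>0$ such that $$\|\phi_0(t,x_0,\sigma)\|\le Me^{-\lambda t}\|x_0\|\quad\text{for all } t\ge 0,\ x_0\in X,\ \sigma\in\mathrm{PC}.$$ Then for every $1\le p\le\infty$ and every $\sigma\in\mathrm{PC}$ the input-to-state map $u\mapsto\phi_u(\cdot,0,\sigma)$ is well defined as a map from $L^p(\mathbb R_+,U)$ to $L^p(\mathbb R_+,X)$ (for every $u\in L^p(\mathbb R_+,U)$ the mild solution with $x_0=0$ exists on $\mathbb R_+$, is unique, depends only on the almost-everywhere class of $u$, and belongs to $L^p(\mathbb R_+,X)$), and it has a finite $L^p$-gain independent of $\sigma$: for every $1\le p\le\infty$ there exists $c_p>0$ such that $$\|\phi_u(\cdot,0,\sigma)\|_{L^p(\mathbb R_+,X)}\le c_p\,\|u\|_{L^p(\mathbb R_+,U)}\quad\text{for all } u\in L^p(\mathbb R_+,U),\ \sigma\in\mathrm{PC}.$$ -/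

import Mathlib

open Set Filter Topology MeasureTheory
open scoped NNReal ENNReal

noncomputable section

/-- `(T t)_{t ≥ 0}` is a `C₀`-semigroup of bounded linear operators on `X`.
Values of `T` at negative times are irrelevant. -/
structure IsC0Semigroup {X : Type*} [NormedAddCommGroup X] [NormedSpace ℝ X]
    (T : ℝ → X →L[ℝ] X) : Prop where
  map_zero : T 0 = ContinuousLinearMap.id ℝ X
  map_add : ∀ s t : ℝ, 0 ≤ s → 0 ≤ t → T (s + t) = (T s).comp (T t)
  continuousOn : ∀ x : X, ContinuousOn (fun t : ℝ => T t x) (Ici 0)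

/-- The (in general unbounded) operator `A` is the infinitesimal generator of `(T t)_{t ≥ 0}`:
`x` belongs to the domain of `A` and `A x = y` if and only if `(T h x - x) / h → y` as `h ↓ 0`. -/
def IsInfinitesimalGenerator {X : Type*} [NormedAddCommGroup X] [NormedSpace ℝ X]
    (A : X →ₗ.[ℝ] X) (T : ℝ → X →L[ℝ] X) : Prop :=
  ∀ x y : X, (x, y) ∈ A.graph ↔
    Tendsto (fun h : ℝ => h⁻¹ • (T h x - x)) (𝓝[>] 0) (𝓝 y)

/-- The set `PC` of piecewise constant switching signals `ℝ₊ → Q`: there are switching times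
`0 = t₀ < t₁ < ⋯ → ∞` such that the signal is constant on each `[t_k, t_{k+1})`.
Values of the signal at negative times are irrelevant. -/
def PC (Q : Type*) : Set (ℝ → Q) :=
  {σ | ∃ (t : ℕ → ℝ) (q : ℕ → Q), t 0 = 0 ∧ StrictMono t ∧ Tendsto t atTop atTop ∧
    ∀ k : ℕ, ∀ s ∈ Ico (t k) (t (k + 1)), σ s = q k}

/-- `x` is a mild solution on `ℝ₊` of `x'(t) = A x(t) + f_{σ(t)}(x(t), u(t))`, `x(0) = x₀`, where
`A` generates `(T t)_{t ≥ 0}`: `x` is continuous on `[0, ∞)` and satisfies the variation of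
constants formula, with an integrable integrand. -/
def IsMildSolution {X U Q : Type*} [NormedAddCommGroup X] [NormedSpace ℝ X]
    (T : ℝ → X →L[ℝ] X) (f : Q → X × U → X) (u : ℝ → U) (x₀ : X) (σ : ℝ → Q)
    (x : ℝ → X) : Prop :=
  ContinuousOn x (Ici 0) ∧
    ∀ t : ℝ, 0 ≤ t →
      IntervalIntegrable (fun s => T (t - s) (f (σ s) (x s, u s))) volume 0 t ∧
      x t = T t x₀ + ∫ s in (0 : ℝ)..t, T (t - s) (f (σ s) (x s, u s))

open Classical in
/-- The trajectory `φ_u(t, x₀, σ)`: the mild solution with input `u`, initial state `x₀` and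
switching signal `σ`, evaluated at time `t`. (The value is `0` if there is no mild solution; for
the systems considered here a mild solution exists and is unique on `ℝ₊`.) -/
def trajectory {X U Q : Type*} [NormedAddCommGroup X] [NormedSpace ℝ X]
    (T : ℝ → X →L[ℝ] X) (f : Q → X × U → X) (u : ℝ → U) (t : ℝ) (x₀ : X) (σ : ℝ → Q) : X :=
  if h : ∃ x : ℝ → X, IsMildSolution T f u x₀ σ x then h.choose t else 0

/-- Uniform global exponential stability at the origin of the system with state space `X`, set of
signals `S` and transition map `φ`. -/
def UGES {X Q : Type*} [NormedAddCommGroup X] (S : Set (ℝ → Q))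
    (φ : ℝ → X → (ℝ → Q) → X) : Prop :=
  ∃ M : ℝ, 0 < M ∧ ∃ lam : ℝ, 0 < lam ∧
    ∀ t : ℝ, 0 ≤ t → ∀ x : X, ∀ σ ∈ S, ‖φ t x σ‖ ≤ M * Real.exp (-lam * t) * ‖x‖

end

/-! No Lyapunov function is needed: stability is used once, over a window of fixed length `τ` with
`M * exp (-lam * τ) ≤ 1/2`. By the cocycle property (`IsMildSolution.shift`) a forced solution
restarted at time `t - τ` can be compared with the unforced trajectory from the same state. Grönwall
(`IsMildSolutionOn.norm_sub_le`) bounds their distance by the `L¹` norm of the input on the window,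
so that `‖x t‖ ≤ ‖x (t - τ)‖ / 2 + D * ∫_{t-τ}^t ‖u‖`.

Taking `L^p` norms turns this into the gain: translation preserves the norm of the first term,
Minkowski bounds the second by `D * τ * ‖u‖_p`, and the half is absorbed on the left
(`eLpNorm_le_of_delay_inequality`). The resulting constant depends neither on `σ` nor on `p`.

Well-posedness comes from Banach's fixed point theorem in an exponentially weighted sup norm on each
`[0, N]`. -/

/-! ### Estimates in `L^p` for delayed inequalities -/

/-- Minkowski's integral inequality for the average of the translates of a function. -/
theorem eLpNorm_lintegral_translate_le {w : ℝ → ℝ≥0∞} (hw : AEMeasurable w volume) (τ : ℝ)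
    {p : ℝ≥0∞} (hp : 1 ≤ p) :
    eLpNorm (fun t => ∫⁻ s in Ioc 0 τ, w (t - s)) p volume ≤
      ENNReal.ofReal τ * eLpNorm w p volume := by
  have hsub : ∀ t : ℝ, AEMeasurable (fun s => w (t - s)) volume := fun t =>
    hw.comp_quasiMeasurePreserving (quasiMeasurePreserving_sub_left_of_right_invariant volume t)
  rcases eq_or_ne p ∞ with rfl | hp'
  · rw [eLpNorm_exponent_top, eLpNorm_exponent_top]
    refine eLpNormEssSup_le_of_ae_enorm_bound (Eventually.of_forall fun t => ?_)
    have h1 : ∀ᵐ s : ℝ, w (t - s) ≤ eLpNormEssSup w volume :=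
      (quasiMeasurePreserving_sub_left_of_right_invariant volume t).ae (enorm_ae_le_eLpNormEssSup w volume)
    calc ∫⁻ s in Ioc 0 τ, w (t - s) ≤ ∫⁻ _ in Ioc 0 τ, eLpNormEssSup w volume :=
          lintegral_mono_ae (ae_restrict_of_ae h1)
      _ = _ := by simp [mul_comm]
  have hp0 : p ≠ 0 := (zero_lt_one.trans_le hp).ne'
  have hr : 1 ≤ p.toReal := by
    rw [← ENNReal.toReal_one]; exact ENNReal.toReal_mono hp' hp
  have hr0 : 0 < p.toReal := by linarith
  rw [eLpNorm_eq_lintegral_rpow_enorm_toReal hp0 hp', eLpNorm_eq_lintegral_rpow_enorm_toReal hp0 hp']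
  simp only [enorm_eq_self]
  -- Hölder on an interval of length `τ`; Tonelli and translation invariance then supply the last
  -- factor `τ`.
  have hpt : ∀ t : ℝ, (∫⁻ s in Ioc 0 τ, w (t - s)) ^ p.toReal ≤
      ENNReal.ofReal τ ^ (p.toReal - 1) * ∫⁻ s in Ioc 0 τ, w (t - s) ^ p.toReal := by
    intro t
    have := eLpNorm_le_eLpNorm_mul_rpow_measure_univ hp
      ((hsub t).restrict (s := Ioc 0 τ)).aestronglyMeasurable
    rw [eLpNorm_one_eq_lintegral_enorm, eLpNorm_eq_lintegral_rpow_enorm_toReal hp0 hp'] at this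
    simp only [enorm_eq_self, Measure.restrict_apply_univ, Real.volume_Ioc, sub_zero,
      ENNReal.toReal_one] at this
    refine (ENNReal.rpow_le_rpow this hr0.le).trans_eq ?_
    rw [ENNReal.mul_rpow_of_nonneg _ _ hr0.le, ← ENNReal.rpow_mul, ← ENNReal.rpow_mul, mul_comm]
    congr 2
    · field_simp
    · rw [one_div_mul_cancel hr0.ne', ENNReal.rpow_one]
  have hprod : AEMeasurable (fun z : ℝ × ℝ => w (z.1 - z.2) ^ p.toReal)
      (volume.prod (volume.restrict (Ioc 0 τ))) :=
    ((hw.comp_quasiMeasurePreserving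
      (quasiMeasurePreserving_sub_of_right_invariant volume (volume.restrict (Ioc 0 τ)))).pow_const _)
  calc (∫⁻ t, (∫⁻ s in Ioc 0 τ, w (t - s)) ^ p.toReal) ^ (1 / p.toReal)
      ≤ (∫⁻ t, ENNReal.ofReal τ ^ (p.toReal - 1) *
          ∫⁻ s in Ioc 0 τ, w (t - s) ^ p.toReal) ^ (1 / p.toReal) := by
        gcongr with t
        exact hpt t
    _ = (ENNReal.ofReal τ ^ p.toReal * ∫⁻ s, w s ^ p.toReal) ^ (1 / p.toReal) := by
        congr 1
        rw [lintegral_const_mul' _ _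
          (ENNReal.rpow_ne_top_of_nonneg (sub_nonneg.2 hr) ENNReal.ofReal_ne_top), lintegral_lintegral_swap hprod]
        have hs : ∀ s : ℝ, ∫⁻ t, w (t - s) ^ p.toReal = ∫⁻ t, w t ^ p.toReal := fun s =>
          lintegral_sub_right_eq_self (fun t => w t ^ p.toReal) s
        simp only [hs]
        rw [lintegral_const, Measure.restrict_apply_univ, Real.volume_Ioc, sub_zero,
          mul_comm (∫⁻ s, w s ^ p.toReal), ← mul_assoc]
        congr 1
        nth_rewrite 2 [← ENNReal.rpow_one (ENNReal.ofReal τ)]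
        rw [← ENNReal.rpow_add_of_nonneg _ _ (sub_nonneg.2 hr) zero_le_one]
        simp
    _ = _ := by
        rw [ENNReal.mul_rpow_of_nonneg _ _ (by positivity), ← ENNReal.rpow_mul,
          mul_one_div_cancel hr0.ne', ENNReal.rpow_one]

/-- A delayed inequality `‖h t‖ ≤ ‖h (t - τ)‖ / 2 + C ∫_{t-τ}^t w` gives an `L^p` bound of `h`
in terms of `w`. -/
theorem eLpNorm_le_of_delay_inequality {E : Type*} [NormedAddCommGroup E] {h : ℝ → E}
    {w : ℝ → ℝ≥0∞} (hh : AEStronglyMeasurable h volume) (hw : AEMeasurable w volume)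
    (hneg : ∀ t < 0, h t = 0) (hbdd : ∀ R : ℝ, ∃ B : ℝ, ∀ t ≤ R, ‖h t‖ ≤ B) {τ : ℝ} (hτ : 0 ≤ τ)
    (C : ℝ≥0) {p : ℝ≥0∞} (hp : 1 ≤ p)
    (hle : ∀ t, 0 ≤ t → ‖h t‖ₑ ≤ 2⁻¹ * ‖h (t - τ)‖ₑ + C * ∫⁻ s in Ioc 0 τ, w (t - s)) :
    eLpNorm h p volume ≤ 2 * (C * (ENNReal.ofReal τ * eLpNorm w p volume)) := by
  set g : ℝ → ℝ≥0∞ := fun t => ∫⁻ s in Ioc 0 τ, w (t - s) with hg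
  have hgm : AEMeasurable g volume :=
    (hw.comp_quasiMeasurePreserving (quasiMeasurePreserving_sub_of_right_invariant volume
      (volume.restrict (Ioc 0 τ)))).lintegral_prod_right'
  have key : ∀ R : ℝ, eLpNorm ((Iic R).indicator h) p volume ≤
      2 * (C * (ENNReal.ofReal τ * eLpNorm w p volume)) := by
    intro R
    set k := (Iic R).indicator h with hk
    have hkm : AEStronglyMeasurable k volume := hh.indicator measurableSet_Iic
    -- Absorbing half of the norm requires it to be finite, hence the truncation at `R`: `k` is
    -- bounded and lives on `[0, R]`.
    have hfin : eLpNorm k p volume ≠ ∞ := by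
      obtain ⟨B, hB⟩ := hbdd R
      have e : k = (Icc 0 R).indicator k := by
        ext t
        by_cases ht : t ∈ Icc 0 R
        · simp [ht]
        · rw [indicator_of_notMem ht, hk, indicator_apply_eq_zero]
          intro h1
          exact hneg t (by by_contra h2; exact ht ⟨not_lt.1 h2, h1⟩)
      rw [e, eLpNorm_indicator_eq_eLpNorm_restrict measurableSet_Icc]
      refine (MemLp.of_bound hkm.restrict B ?_).eLpNorm_ne_top
      filter_upwards [ae_restrict_mem measurableSet_Icc] with t ht
      rw [hk, indicator_of_mem (show t ∈ Iic R from ht.2)]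
      exact hB t ht.2
    have hpt : ∀ t, ‖k t‖ₑ ≤ 2⁻¹ * ‖k (t - τ)‖ₑ + C * g t := by
      intro t
      by_cases ht : t ≤ R
      · rw [hk, indicator_of_mem (show t ∈ Iic R from ht),
          indicator_of_mem (show t - τ ∈ Iic R from by simp only [mem_Iic]; linarith)]
        rcases lt_or_ge t 0 with h0 | h0
        · simp [hneg t h0]
        · exact hle t h0
      · rw [hk, indicator_of_notMem (show t ∉ Iic R from ht)]
        simp
    have hkt : AEMeasurable (fun t => ‖k (t - τ)‖ₑ) volume :=
      (hkm.comp_measurePreserving (measurePreserving_sub_right volume τ)).enorm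
    have hmain : eLpNorm k p volume ≤
        2⁻¹ * eLpNorm k p volume + C * eLpNorm g p volume := by
      calc eLpNorm k p volume ≤ eLpNorm (fun t => 2⁻¹ * ‖k (t - τ)‖ₑ + C * g t) p volume :=
            eLpNorm_mono_enorm (fun t => by simpa using hpt t)
        _ ≤ eLpNorm (fun t => 2⁻¹ * ‖k (t - τ)‖ₑ) p volume + eLpNorm (fun t => C * g t) p volume :=
            eLpNorm_add_le (hkt.const_mul _).aestronglyMeasurable
              (hgm.const_mul _).aestronglyMeasurable hp
        _ ≤ _ := by
            gcongr
            · refine (eLpNorm_le_mul_eLpNorm_of_ae_le_mul'' (c := 2⁻¹) p hkt.aestronglyMeasurable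
                (Eventually.of_forall fun t => by simp)).trans_eq ?_
              rw [← eLpNorm_comp_measurePreserving hkm (measurePreserving_sub_right volume τ)]
              exact congrArg _ (eLpNorm_enorm (k ∘ fun t => t - τ))
            · exact eLpNorm_le_mul_eLpNorm_of_ae_le_mul'' p hgm.aestronglyMeasurable
                (Eventually.of_forall fun t => by simp)
    have hsplit : eLpNorm k p volume = 2⁻¹ * eLpNorm k p volume + 2⁻¹ * eLpNorm k p volume := by
      rw [← add_mul, ENNReal.inv_two_add_inv_two, one_mul]
    have hhalf : 2⁻¹ * eLpNorm k p volume ≤ C * eLpNorm g p volume := by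
      nth_rewrite 1 [hsplit] at hmain
      exact (ENNReal.add_le_add_iff_left (ENNReal.mul_ne_top (by simp) hfin)).1 hmain
    calc eLpNorm k p volume = 2 * (2⁻¹ * eLpNorm k p volume) := by
          rw [← mul_assoc, ENNReal.mul_inv_cancel (by simp) (by simp), one_mul]
      _ ≤ _ := by
          refine mul_le_mul_right (hhalf.trans (mul_le_mul_right ?_ _)) _
          exact eLpNorm_lintegral_translate_le hw τ hp
  -- The bound is uniform in `R`, so Fatou removes the truncation, also for `p = ∞`.
  refine (Lp.eLpNorm_lim_le_liminf_eLpNorm (f := fun n : ℕ => (Iic (n : ℝ)).indicator h)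
    (fun n => hh.indicator measurableSet_Iic) h (Eventually.of_forall fun t => ?_)).trans ?_
  · refine tendsto_const_nhds.congr' ?_
    filter_upwards [eventually_ge_atTop ⌈t⌉₊] with n hn
    rw [indicator_of_mem]
    exact (Nat.le_ceil t).trans (by exact_mod_cast hn)
  · exact liminf_le_of_le (by isBoundedDefault)  (fun b hb => by
      obtain ⟨n, hn⟩ := hb.exists
      exact hn.trans (key n))

/-! ### Grönwall's inequality -/

theorem integral_exp_mul_le {ρ : ℝ} (hρ : 0 < ρ) (t : ℝ) :
    ∫ s in (0 : ℝ)..t, Real.exp (ρ * s) ≤ Real.exp (ρ * t) / ρ := by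
  have h : ∀ s ∈ uIcc 0 t, HasDerivAt (fun s => Real.exp (ρ * s) / ρ) (Real.exp (ρ * s)) s := by
    intro s _
    have := ((hasDerivAt_id s).const_mul ρ).exp.div_const ρ
    simpa [hρ.ne'] using this
  rw [intervalIntegral.integral_eq_sub_of_hasDerivAt h
    (Continuous.intervalIntegrable (by fun_prop) _ _)]
  simp only [mul_zero, Real.exp_zero, sub_le_self_iff]
  positivity

/-- Grönwall's inequality in integral form, with a non-optimal exponent. -/
theorem le_of_le_add_mul_integral {d : ℝ → ℝ} {N B a : ℝ} (hd : ContinuousOn d (Icc 0 N))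
    (ha : 0 < a) (hB : 0 ≤ B)
    (h : ∀ t ∈ Icc 0 N, d t ≤ B + a * ∫ s in (0 : ℝ)..t, d s) :
    ∀ t ∈ Icc 0 N, d t ≤ 2 * B * Real.exp (2 * a * N) := by
  intro t ht
  -- Evaluating the hypothesis at a maximum point of `exp (-2at) * d t` gives `μ ≤ B + μ / 2`; the
  -- weight `2a` is what produces the factor `1/2`.
  obtain ⟨m, hm, hmax⟩ := isCompact_Icc.exists_isMaxOn ⟨t, ht⟩
    (f := fun t => Real.exp (-(2 * a * t)) * d t)
    ((Continuous.continuousOn (by fun_prop)).mul hd)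
  set μ := Real.exp (-(2 * a * m)) * d m with hμ
  have hdle : ∀ s ∈ Icc 0 N, d s ≤ μ * Real.exp (2 * a * s) := by
    intro s hs
    have h1 : Real.exp (-(2 * a * s)) * d s ≤ μ := hmax hs
    calc d s = (Real.exp (-(2 * a * s)) * d s) * Real.exp (2 * a * s) := by
          rw [mul_right_comm, ← Real.exp_add]; simp
      _ ≤ _ := by gcongr
  rcases le_or_gt μ 0 with h0 | h0
  · refine (hdle t ht).trans ((mul_nonpos_of_nonpos_of_nonneg h0 (Real.exp_pos _).le).trans ?_)
    positivity
  have hm2 : μ ≤ 2 * B := by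
    have hint : ∫ s in (0 : ℝ)..m, d s ≤ μ * (Real.exp (2 * a * m) / (2 * a)) := by
      calc ∫ s in (0 : ℝ)..m, d s ≤ ∫ s in (0 : ℝ)..m, μ * Real.exp (2 * a * s) := by
            refine intervalIntegral.integral_mono_on hm.1 ?_
              (Continuous.intervalIntegrable (by fun_prop) _ _)
              fun s hs => hdle s ⟨hs.1, hs.2.trans hm.2⟩
            exact (hd.mono (by rw [uIcc_of_le hm.1]; exact Icc_subset_Icc_right hm.2)).intervalIntegrable
        _ ≤ _ := by
            rw [intervalIntegral.integral_const_mul]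
            gcongr
            exact integral_exp_mul_le (by positivity) m
    have h1 : d m ≤ B + μ * Real.exp (2 * a * m) / 2 := by
      refine (h m hm).trans ?_
      have : a * ∫ s in (0 : ℝ)..m, d s ≤ a * (μ * (Real.exp (2 * a * m) / (2 * a))) := by gcongr
      refine (add_le_add_right this B).trans_eq ?_
      field_simp
    have h2 : μ ≤ Real.exp (-(2 * a * m)) * (B + μ * Real.exp (2 * a * m) / 2) := by
      rw [hμ]; gcongr
    have h3 : Real.exp (-(2 * a * m)) * (B + μ * Real.exp (2 * a * m) / 2)
        = Real.exp (-(2 * a * m)) * B + μ / 2 := by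
      rw [mul_add]
      congr 1
      calc _ = (Real.exp (-(2 * a * m)) * Real.exp (2 * a * m)) * μ / 2 := by ring
        _ = _ := by rw [← Real.exp_add]; simp
    have h4 : Real.exp (-(2 * a * m)) ≤ 1 := by
      rw [Real.exp_le_one_iff]
      have := hm.1
      have : 0 ≤ 2 * a * m := by positivity
      linarith
    have h5 : Real.exp (-(2 * a * m)) * B ≤ B := mul_le_of_le_one_left hB h4
    linarith
  calc d t ≤ μ * Real.exp (2 * a * t) := hdle t ht
    _ ≤ 2 * B * Real.exp (2 * a * N) := by
      gcongr
      exact ht.2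

/-! ### Strongly continuous semigroups and their convolutions -/

section Semigroup

variable {X : Type*} [NormedAddCommGroup X] [NormedSpace ℝ X]
  {T : ℝ → X →L[ℝ] X}

theorem IsC0Semigroup.continuous_max (hT : IsC0Semigroup T) (x : X) :
    Continuous (fun r : ℝ => T (max r 0) x) :=
  (hT.continuousOn x).comp_continuous (by fun_prop) fun r => le_max_right r 0

variable [CompleteSpace X]

theorem IsC0Semigroup.exists_norm_le (hT : IsC0Semigroup T) (N : ℝ) :
    ∃ K : ℝ, 0 < K ∧ ∀ r ∈ Icc 0 N, ‖T r‖ ≤ K := by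
  obtain ⟨C, hC⟩ := banach_steinhaus (g := fun r : Icc 0 N => T r) (fun x => by
    obtain ⟨C, hC⟩ := isCompact_Icc.exists_bound_of_continuousOn
      ((hT.continuousOn x).mono (t := Icc 0 N) Icc_subset_Ici_self)
    exact ⟨C, fun r => hC r r.2⟩)
  exact ⟨max C 1, by positivity, fun r hr => (hC ⟨r, hr⟩).trans (le_max_left _ _)⟩

/-- A `C₀`-semigroup, extended by the identity to negative times, is jointly continuous. -/
theorem IsC0Semigroup.continuous_uncurry (hT : IsC0Semigroup T) :
    Continuous (fun z : ℝ × X => T (max z.1 0) z.2) := by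
  rw [continuous_iff_continuousAt]
  rintro ⟨r, x⟩
  obtain ⟨K, hK, hTK⟩ := hT.exists_norm_le (max r 0 + 1)
  -- Split `T z.2 = T (z.2 - x) + T x`: the local uniform bound handles the first term, strong
  -- continuity the second.
  have h1 : Tendsto (fun z : ℝ × X => T (max z.1 0) x) (𝓝 (r, x)) (𝓝 (T (max r 0) x)) :=
    ((hT.continuous_max x).comp continuous_fst).continuousAt
  have h2 : Tendsto (fun z : ℝ × X => T (max z.1 0) (z.2 - x)) (𝓝 (r, x)) (𝓝 0) := by
    have h3 : Tendsto (fun z : ℝ × X => K * ‖z.2 - x‖) (𝓝 (r, x)) (𝓝 0) := by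
      have : Continuous (fun z : ℝ × X => K * ‖z.2 - x‖) := by fun_prop
      simpa using this.tendsto (r, x)
    refine squeeze_zero_norm' ?_ h3
    have h4 : ∀ᶠ z : ℝ × X in 𝓝 (r, x), max z.1 0 < max r 0 + 1 :=
      (continuous_fst.max continuous_const).continuousAt.eventually_lt_const (by simp)
    filter_upwards [h4] with z hz
    exact (T _).le_of_opNorm_le (hTK _ ⟨le_max_right _ _, hz.le⟩) _
  refine (h2.add h1).congr' (Eventually.of_forall fun z => ?_) |>.trans ?_
  · simp
  · simp

variable {g : ℝ → X} {N : ℝ}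

/-- Joint continuity is essential here: `T` is only strongly continuous, so it need not be
measurable in operator norm. -/
theorem IsC0Semigroup.aestronglyMeasurable_apply (hT : IsC0Semigroup T) {μ : Measure ℝ}
    (hg : AEStronglyMeasurable g μ) (t : ℝ) :
    AEStronglyMeasurable (fun s => T (max (t - s) 0) (g s)) μ :=
  hT.continuous_uncurry.comp_aestronglyMeasurable
    (f := fun s => (t - s, g s)) ((by fun_prop : Continuous fun s => t - s).aestronglyMeasurable.prodMk hg)

theorem IsC0Semigroup.intervalIntegrable_apply (hT : IsC0Semigroup T)
    (hg : IntegrableOn g (Icc 0 N)) {t : ℝ} (ht : t ∈ Icc 0 N) :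
    IntervalIntegrable (fun s => T (t - s) (g s)) volume 0 t := by
  obtain ⟨K, hK, hTK⟩ := hT.exists_norm_le N
  rw [intervalIntegrable_iff_integrableOn_Ioc_of_le ht.1]
  have hsub : Ioc 0 t ⊆ Icc 0 N := fun s hs => ⟨hs.1.le, hs.2.trans ht.2⟩
  have hg' := hg.mono_set hsub
  refine (hg'.norm.const_mul K).mono' ?_ ?_
  · refine (hT.aestronglyMeasurable_apply hg'.aestronglyMeasurable t).congr ?_
    filter_upwards [ae_restrict_mem measurableSet_Ioc] with s hs
    rw [max_eq_left (sub_nonneg.2 hs.2)]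
  · filter_upwards [ae_restrict_mem measurableSet_Ioc] with s hs
    exact (T _).le_of_opNorm_le (hTK _ ⟨sub_nonneg.2 hs.2, by linarith [hs.1, ht.2]⟩) _

/-- Dominated convergence for an integral whose parameter and endpoint both move, restricted to the
diagonal. -/
theorem IsC0Semigroup.continuousOn_convolution (hT : IsC0Semigroup T)
    (hg : IntegrableOn g (Icc 0 N)) :
    ContinuousOn (fun t => ∫ s in (0 : ℝ)..t, T (t - s) (g s)) (Icc 0 N) := by
  -- The parametric lemma needs open room around `[0, N]`; with `s > -1` and `r < N + 1` the time `r
  -- - s` stays below `N + 2`.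
  obtain ⟨K, hK, hTK⟩ := hT.exists_norm_le (N + 2)
  set k := (Icc 0 N).indicator g with hk
  have hki : Integrable k := hg.integrable_indicator measurableSet_Icc
  have hcont : ∀ t ∈ Icc 0 N,
      ContinuousAt (fun t => ∫ s in (0 : ℝ)..t, T (max (t - s) 0) (k s)) t := by
    intro t ht
    have hF := intervalIntegral.continuousAt_parametric_primitive_of_dominated
      (μ := volume) (F := fun t s => T (max (t - s) 0) (k s)) (fun s => K * ‖k s‖) (-1) (N + 1)
      (a₀ := 0) (b₀ := t) (x₀ := t)
      (fun t => hT.aestronglyMeasurable_apply hki.aestronglyMeasurable.restrict t) ?_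
      (hki.norm.const_mul K).intervalIntegrable
      (Eventually.of_forall fun s =>
        ((hT.continuous_max (k s)).comp (by fun_prop : Continuous fun t => t - s)).continuousAt)
      ⟨by norm_num, by linarith [ht.1, ht.2]⟩ ⟨by linarith [ht.1], by linarith [ht.2]⟩
      (measure_singleton _)
    · exact hF.comp (f := fun t : ℝ => (t, t)) (by fun_prop)
    · filter_upwards [Iio_mem_nhds (show t < N + 1 by linarith [ht.2])] with r hr
      filter_upwards [ae_restrict_mem measurableSet_uIoc] with s hs
      rw [uIoc_of_le (by linarith [ht.1, ht.2])] at hs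
      have hs1 := hs.1
      have hr1 : r < N + 1 := hr
      have hN : 0 ≤ N := ht.1.trans ht.2
      exact (T _).le_of_opNorm_le (hTK _ ⟨le_max_right _ _, max_le (by linarith) (by linarith)⟩) _
  refine ContinuousOn.congr (fun t ht => (hcont t ht).continuousWithinAt) fun t ht => ?_
  refine intervalIntegral.integral_congr fun s hs => ?_
  rw [uIcc_of_le ht.1] at hs
  have hs' : s ∈ Icc 0 N := ⟨hs.1, hs.2.trans ht.2⟩
  rw [max_eq_left (sub_nonneg.2 hs.2), hk, indicator_of_mem hs']

/-- Serves both the contraction estimate and the Grönwall estimate. -/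
theorem IsC0Semigroup.norm_integral_sub_le (hT : IsC0Semigroup T) {g k : ℝ → X} {K : ℝ}
    (hTK : ∀ r ∈ Icc 0 N, ‖T r‖ ≤ K) (hg : IntegrableOn g (Icc 0 N))
    (hk : IntegrableOn k (Icc 0 N)) {t : ℝ} (ht : t ∈ Icc 0 N) {b : ℝ → ℝ}
    (hb : IntervalIntegrable b volume 0 t) (hgk : ∀ s ∈ Icc 0 t, ‖g s - k s‖ ≤ b s) (hK : 0 ≤ K) :
    ‖(∫ s in (0 : ℝ)..t, T (t - s) (g s)) - ∫ s in (0 : ℝ)..t, T (t - s) (k s)‖ ≤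
      K * ∫ s in (0 : ℝ)..t, b s := by
  rw [← intervalIntegral.integral_sub (hT.intervalIntegrable_apply hg ht)
    (hT.intervalIntegrable_apply hk ht), ← intervalIntegral.integral_const_mul]
  refine intervalIntegral.norm_integral_le_of_norm_le ht.1 ?_ (hb.const_mul K)
  refine Eventually.of_forall fun s hs => ?_
  rw [← map_sub]
  refine ((T _).le_of_opNorm_le (hTK _ ⟨sub_nonneg.2 hs.2, by linarith [hs.1, ht.2]⟩) _).trans ?_
  gcongr
  exact hgk s ⟨hs.1.le, hs.2⟩

end Semigroup

/-! ### Switching signals -/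

/-- `Q` carries no measurable structure, so measurability is checked on each of the countably many
intervals where `σ` is constant. -/
theorem PC.aestronglyMeasurable_comp {E F Q : Type*} [TopologicalSpace E] [TopologicalSpace F]
    [TopologicalSpace.PseudoMetrizableSpace F]
    {σ : ℝ → Q} (hσ : σ ∈ PC Q) {f : Q → E → F} (hf : ∀ q, Continuous (f q)) {z : ℝ → E} {N : ℝ}
    (hz : AEStronglyMeasurable z (volume.restrict (Icc 0 N))) :
    AEStronglyMeasurable (fun s => f (σ s) (z s)) (volume.restrict (Icc 0 N)) := by
  obtain ⟨t, q, h0, hmono, htop, hq⟩ := hσ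
  have hcover : Icc 0 N ⊆ ⋃ k, Icc 0 N ∩ Ico (t k) (t (k + 1)) := by
    intro s hs
    have hex : ∃ n, s < t n := (htop.eventually_gt_atTop s).exists
    classical
    have hpos : Nat.find hex ≠ 0 := by
      intro h
      have := Nat.find_spec hex
      rw [h, h0] at this
      exact absurd hs.1 (not_le.2 this)
    obtain ⟨k, hk⟩ := Nat.exists_eq_succ_of_ne_zero hpos
    refine mem_iUnion.2 ⟨k, hs, ?_, ?_⟩
    · exact not_lt.1 (Nat.find_min hex (m := k) (by omega))
    · have := Nat.find_spec hex
      rwa [hk] at this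
  refine AEStronglyMeasurable.mono_set hcover (aestronglyMeasurable_iUnion_iff.2 fun k => ?_)
  refine ((hf (q k)).comp_aestronglyMeasurable (hz.mono_set inter_subset_left)).congr ?_
  filter_upwards [ae_restrict_mem (measurableSet_Icc.inter measurableSet_Ico)] with s hs
  rw [hq k s hs.2]

theorem PC.shift {Q : Type*} {σ : ℝ → Q} (hσ : σ ∈ PC Q) {a : ℝ} (ha : 0 ≤ a) :
    (fun t => σ (a + t)) ∈ PC Q := by
  obtain ⟨t, q, h0, hmono, htop, hq⟩ := hσ
  have hex : ∃ n, a < t n := (htop.eventually_gt_atTop a).exists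
  classical
  have hpos : Nat.find hex ≠ 0 := by
    intro h
    have := Nat.find_spec hex
    rw [h, h0] at this
    exact absurd ha (not_le.2 this)
  obtain ⟨k, hk⟩ := Nat.exists_eq_succ_of_ne_zero hpos
  have hk1 : t k ≤ a := not_lt.1 (Nat.find_min hex (m := k) (by omega))
  have hk2 : a < t (k + 1) := by
    have := Nat.find_spec hex
    rwa [hk] at this
  -- `k` indexes the interval containing `a`; its remainder becomes the first interval, so only the
  -- time `t k - a ≤ 0` is replaced by `0`.
  refine ⟨fun n => if n = 0 then 0 else t (k + n) - a, fun n => q (k + n), by simp, ?_, ?_, ?_⟩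
  · refine strictMono_nat_of_lt_succ fun n => ?_
    rcases Nat.eq_zero_or_pos n with rfl | hn
    · simpa using hk2
    · simp only [hn.ne', if_false, Nat.succ_ne_zero]
      exact sub_lt_sub_right (hmono (by omega)) a
  · have h1 : Tendsto (fun n => t (k + n) - a) atTop atTop :=
      tendsto_atTop_add_const_right _ (-a) (htop.comp (tendsto_add_atTop_nat k |>.congr
        fun n => Nat.add_comm n k))
    refine h1.congr' ?_
    filter_upwards [eventually_gt_atTop 0] with n hn
    simp [hn.ne']
  · intro n s hs
    simp only [Nat.succ_ne_zero, if_false] at hs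
    refine hq (k + n) (a + s) ⟨?_, ?_⟩
    · have := hs.1
      split_ifs at this with hn
      · subst hn; simp only [add_zero]; linarith
      · linarith
    · have := hs.2
      rw [← add_assoc] at this
      linarith

/-- The Lipschitz bound together with `f q (0, 0) = 0` gives linear growth. -/
theorem integrableOn_forcing {X U Q : Type*} [NormedAddCommGroup X] [NormedAddCommGroup U]
    {f : Q → X × U → X} {L : ℝ≥0} {σ : ℝ → Q} {N : ℝ} (hf : ∀ q, LipschitzWith L (f q)) (hf0 : ∀ q, f q (0, 0) = 0)
    (hσ : σ ∈ PC Q) {x : ℝ → X} (hx : ContinuousOn x (Icc 0 N)) {u : ℝ → U}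
    (hu : IntegrableOn u (Icc 0 N)) :
    IntegrableOn (fun s => f (σ s) (x s, u s)) (Icc 0 N) := by
  have hxi : IntegrableOn x (Icc 0 N) := hx.integrableOn_compact isCompact_Icc
  have hz : IntegrableOn (fun s => (x s, u s)) (Icc 0 N) := hxi.prodMk hu
  refine (hz.norm.const_mul (L : ℝ)).mono'
    (PC.aestronglyMeasurable_comp hσ (fun q => (hf q).continuous) hz.aestronglyMeasurable)
    (Eventually.of_forall fun s => ?_)
  have := (hf (σ s)).norm_sub_le (x s, u s) (0, 0)
  rwa [hf0, sub_zero, Prod.mk_zero_zero, sub_zero] at this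

/-! ### Mild solutions: cocycle property, uniqueness, existence -/

section System

variable {X U Q : Type*} [NormedAddCommGroup X] [NormedSpace ℝ X]
  {T : ℝ → X →L[ℝ] X} {f : Q → X × U → X} {L : ℝ≥0} {σ : ℝ → Q} {N : ℝ}

/-- `x` satisfies the variation of constants formula on the bounded interval `[0, N]`. -/
def IsMildSolutionOn (T : ℝ → X →L[ℝ] X) (f : Q → X × U → X) (u : ℝ → U) (x₀ : X) (σ : ℝ → Q)
    (N : ℝ) (x : ℝ → X) : Prop :=
  ContinuousOn x (Icc 0 N) ∧
    ∀ t ∈ Icc 0 N, x t = T t x₀ + ∫ s in (0 : ℝ)..t, T (t - s) (f (σ s) (x s, u s))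

theorem IsMildSolutionOn.mono {u : ℝ → U} {x₀ : X} {x : ℝ → X} {N' : ℝ}
    (hx : IsMildSolutionOn T f u x₀ σ N x) (h : N' ≤ N) : IsMildSolutionOn T f u x₀ σ N' x :=
  ⟨hx.1.mono (Icc_subset_Icc_right h), fun t ht => hx.2 t ⟨ht.1, ht.2.trans h⟩⟩

theorem IsMildSolution.isMildSolutionOn {u : ℝ → U} {x₀ : X} {x : ℝ → X}
    (hx : IsMildSolution T f u x₀ σ x) (N : ℝ) : IsMildSolutionOn T f u x₀ σ N x :=
  ⟨hx.1.mono fun _ ht => ht.1, fun t ht => (hx.2 t ht.1).2⟩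

variable [CompleteSpace X]

/-- The cocycle property of mild solutions. -/
theorem IsMildSolution.shift (hT : IsC0Semigroup T) {u : ℝ → U} {x₀ : X} {x : ℝ → X}
    (hx : IsMildSolution T f u x₀ σ x) {a : ℝ} (ha : 0 ≤ a) :
    IsMildSolution T f (fun t => u (a + t)) (x a) (fun t => σ (a + t)) (fun t => x (a + t)) := by
  refine ⟨hx.1.comp (by fun_prop) (fun t ht => add_nonneg ha ht), fun t ht => ?_⟩
  obtain ⟨hi, he⟩ := hx.2 (a + t) (add_nonneg ha ht)
  obtain ⟨hia, hea⟩ := hx.2 a ha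
  have hi1 : IntervalIntegrable (fun s => T (a + t - s) (f (σ s) (x s, u s))) volume 0 a :=
    hi.mono_set (uIcc_subset_uIcc left_mem_uIcc
      (by rw [uIcc_of_le (add_nonneg ha ht)]; exact ⟨ha, le_add_of_nonneg_right ht⟩))
  have hi2 : IntervalIntegrable (fun s => T (a + t - s) (f (σ s) (x s, u s))) volume a (a + t) :=
    hi.mono_set (uIcc_subset_uIcc
      (by rw [uIcc_of_le (add_nonneg ha ht)]; exact ⟨ha, le_add_of_nonneg_right ht⟩) right_mem_uIcc)
  have hcomp : (fun s => T (t - s) (f (σ (a + s)) (x (a + s), u (a + s)))) =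
      fun s => T (a + t - (a + s)) (f (σ (a + s)) (x (a + s), u (a + s))) := by
    funext s; rw [add_sub_add_left_eq_sub]
  constructor
  · rw [hcomp]
    simpa using hi2.comp_add_left a
  · change x (a + t) = _
    rw [hcomp, intervalIntegral.integral_comp_add_left
      (fun s => T (a + t - s) (f (σ s) (x s, u s))) a, add_zero, he,
      ← intervalIntegral.integral_add_adjacent_intervals hi1 hi2, ← add_assoc]
    -- Past forcing on `[0, a]` is absorbed into `T t (x a)` by pulling `T t` out of the integral.
    congr 1
    rw [hea, map_add, ← ContinuousLinearMap.intervalIntegral_comp_comm _ hia, add_comm a t,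
      hT.map_add t a ht ha]
    congr 1
    refine intervalIntegral.integral_congr fun s hs => ?_
    rw [uIcc_of_le ha] at hs
    rw [add_sub_assoc, hT.map_add t (a - s) ht (sub_nonneg.2 hs.2)]
    rfl

variable [NormedAddCommGroup U]

/-- Continuous dependence of mild solutions on the input. -/
theorem IsMildSolutionOn.norm_sub_le (hT : IsC0Semigroup T) (hf : ∀ q, LipschitzWith L (f q))
    (hf0 : ∀ q, f q (0, 0) = 0) (hσ : σ ∈ PC Q) {K : ℝ} (hK : 0 < K)
    (hTK : ∀ r ∈ Icc 0 N, ‖T r‖ ≤ K) {u v : ℝ → U} (hu : IntegrableOn u (Icc 0 N))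
    (hv : IntegrableOn v (Icc 0 N)) {x₀ : X} {x y : ℝ → X}
    (hx : IsMildSolutionOn T f u x₀ σ N x) (hy : IsMildSolutionOn T f v x₀ σ N y) :
    ∀ t ∈ Icc 0 N, ‖x t - y t‖ ≤
      2 * (K * L * ∫ s in Icc 0 N, ‖u s - v s‖) * Real.exp (2 * (K * L + 1) * N) := by
  have hd : ContinuousOn (fun t => ‖x t - y t‖) (Icc 0 N) := (hx.1.sub hy.1).norm
  have huv : IntegrableOn (fun s => ‖u s - v s‖) (Icc 0 N) := (hu.sub hv).norm
  -- The rate is `K * L + 1` because Grönwall is stated for a positive rate and `L` may be `0`.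
  refine le_of_le_add_mul_integral hd (by positivity) (by positivity) fun t ht => ?_
  have hd' : IntervalIntegrable (fun t => ‖x t - y t‖) volume 0 t :=
    (hd.mono (by rw [uIcc_of_le ht.1]; exact Icc_subset_Icc_right ht.2)).intervalIntegrable
  have huv' : IntervalIntegrable (fun t => ‖u t - v t‖) volume 0 t := by
    rw [intervalIntegrable_iff_integrableOn_Ioc_of_le ht.1]
    exact huv.mono_set fun s hs => ⟨hs.1.le, hs.2.trans ht.2⟩
  have hmain := hT.norm_integral_sub_le hTK (integrableOn_forcing hf hf0 hσ hx.1 hu)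
    (integrableOn_forcing hf hf0 hσ hy.1 hv) ht
    (b := fun s => L * (‖x s - y s‖ + ‖u s - v s‖)) ((hd'.add huv').const_mul _)
    (fun s _ => by
      refine ((hf (σ s)).norm_sub_le _ _).trans ?_
      gcongr
      rw [Prod.mk_sub_mk, Prod.norm_def]
      exact max_le_add_of_nonneg (norm_nonneg _) (norm_nonneg _)) hK.le
  rw [intervalIntegral.integral_const_mul, intervalIntegral.integral_add hd' huv'] at hmain
  have h1 : ∫ s in (0 : ℝ)..t, ‖u s - v s‖ ≤ ∫ s in Icc 0 N, ‖u s - v s‖ := by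
    rw [intervalIntegral.integral_of_le ht.1]
    exact setIntegral_mono_set huv (Eventually.of_forall fun s => norm_nonneg _)
      (LE.le.eventuallyLE fun s hs => ⟨hs.1.le, hs.2.trans ht.2⟩)
  have h2 : 0 ≤ ∫ s in (0 : ℝ)..t, ‖x s - y s‖ :=
    intervalIntegral.integral_nonneg ht.1 fun s _ => norm_nonneg _
  rw [hx.2 t ht, hy.2 t ht, add_sub_add_left_eq_sub]
  have h3 : K * L * (∫ s in (0 : ℝ)..t, ‖u s - v s‖) ≤ K * L * ∫ s in Icc 0 N, ‖u s - v s‖ := by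
    gcongr
  refine hmain.trans ?_
  linarith

/-- Mild solutions on a bounded interval are unique and depend only on the a.e. class of the
input. -/
theorem IsMildSolutionOn.eqOn (hT : IsC0Semigroup T) (hf : ∀ q, LipschitzWith L (f q))
    (hf0 : ∀ q, f q (0, 0) = 0) (hσ : σ ∈ PC Q) {u v : ℝ → U} (hu : IntegrableOn u (Icc 0 N))
    (huv : u =ᵐ[volume.restrict (Icc 0 N)] v) {x₀ : X} {x y : ℝ → X}
    (hx : IsMildSolutionOn T f u x₀ σ N x) (hy : IsMildSolutionOn T f v x₀ σ N y) :
    EqOn x y (Icc 0 N) := by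
  intro t ht
  obtain ⟨K, hK, hTK⟩ := hT.exists_norm_le N
  have h := hx.norm_sub_le hT hf hf0 hσ hK hTK hu (hu.congr huv) hy t ht
  have h0 : ∫ s in Icc 0 N, ‖u s - v s‖ = 0 := by
    rw [integral_eq_zero_of_ae]
    filter_upwards [huv] with s hs
    simp [hs]
  rw [h0] at h
  simp only [mul_zero, zero_mul] at h
  exact sub_eq_zero.1 (norm_le_zero_iff.1 h)

/-- The fixed point is sought for `y s = exp (-ρ s) * x s`, with `W y` undoing the weight. The
contraction factor is `K * L / ρ ≤ 1/2`, so one step covers all of `[0, N]`. -/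
theorem exists_isMildSolutionOn (hT : IsC0Semigroup T) (hf : ∀ q, LipschitzWith L (f q))
    (hf0 : ∀ q, f q (0, 0) = 0) (hσ : σ ∈ PC Q) (hN : 0 ≤ N) {u : ℝ → U}
    (hu : IntegrableOn u (Icc 0 N)) (x₀ : X) : ∃ x, IsMildSolutionOn T f u x₀ σ N x := by
  obtain ⟨K, hK, hTK⟩ := hT.exists_norm_le N
  set ρ : ℝ := 2 * (K * L + 1) with hρ
  have hρ0 : 0 < ρ := by positivity
  let W : C(Icc 0 N, X) → ℝ → X := fun y s => Real.exp (ρ * s) • IccExtend hN y s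
  have hWc : ∀ y, ContinuousOn (W y) (Icc 0 N) := fun y =>
    ((by fun_prop : Continuous fun s => Real.exp (ρ * s)).smul y.continuous.Icc_extend').continuousOn
  have hWi : ∀ y, IntegrableOn (fun s => f (σ s) (W y s, u s)) (Icc 0 N) := fun y =>
    integrableOn_forcing hf hf0 hσ (hWc y) hu
  let G : C(Icc 0 N, X) → ℝ → X := fun y t =>
    T t x₀ + ∫ s in (0 : ℝ)..t, T (t - s) (f (σ s) (W y s, u s))
  have hGc : ∀ y, ContinuousOn (G y) (Icc 0 N) := fun y =>
    ((hT.continuousOn x₀).mono Icc_subset_Ici_self).add (hT.continuousOn_convolution (hWi y))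
  let Φ : C(Icc 0 N, X) → C(Icc 0 N, X) := fun y =>
    ⟨fun t => Real.exp (-(ρ * t)) • G y t,
      (by fun_prop : Continuous fun t : Icc 0 N => Real.exp (-(ρ * t))).smul
        (continuousOn_iff_continuous_domRestrict.1 (hGc y))⟩
  have hΦ : ContractingWith 2⁻¹ Φ := by
    refine ⟨by norm_num, LipschitzWith.of_dist_le_mul fun y z => ?_⟩
    rw [ContinuousMap.dist_le (by positivity)]
    intro t
    have hmain := hT.norm_integral_sub_le hTK (hWi y) (hWi z) t.2
      (b := fun s => L * (Real.exp (ρ * s) * dist y z))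
      (Continuous.intervalIntegrable (by fun_prop) _ _)
      (fun s hs => by
        refine ((hf (σ s)).norm_sub_le _ _).trans ?_
        gcongr
        have hs' : s ∈ Icc 0 N := ⟨hs.1, hs.2.trans t.2.2⟩
        rw [Prod.mk_sub_mk, Prod.norm_def, sub_self, norm_zero, max_eq_left (norm_nonneg _)]
        simp only [W]
        rw [← smul_sub, norm_smul, Real.norm_of_nonneg (Real.exp_pos _).le,
          IccExtend_of_mem _ _ hs', IccExtend_of_mem _ _ hs', ← dist_eq_norm]
        gcongr
        exact ContinuousMap.dist_apply_le_dist _) hK.le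
    rw [intervalIntegral.integral_const_mul, intervalIntegral.integral_mul_const] at hmain
    have h1 := integral_exp_mul_le hρ0 t
    have h2 : dist (Φ y t) (Φ z t) ≤ Real.exp (-(ρ * t)) *
        (K * (L * (Real.exp (ρ * t) / ρ * dist y z))) := by
      simp only [Φ, ContinuousMap.coe_mk]
      rw [dist_eq_norm, ← smul_sub, norm_smul, Real.norm_of_nonneg (Real.exp_pos _).le]
      gcongr
      simp only [G, add_sub_add_left_eq_sub]
      refine hmain.trans ?_
      gcongr
    refine h2.trans ?_
    have h3 : Real.exp (-(ρ * t)) * (K * (L * (Real.exp (ρ * t) / ρ * dist y z))) =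
        (Real.exp (-(ρ * t)) * Real.exp (ρ * t)) * (K * L / ρ) * dist y z := by ring
    rw [h3, ← Real.exp_add, neg_add_cancel, Real.exp_zero, one_mul]
    gcongr
    rw [div_le_iff₀ hρ0, hρ]
    push_cast
    linarith
  have hfix := hΦ.fixedPoint_isFixedPt
  set y := hΦ.fixedPoint Φ with hy
  refine ⟨W y, hWc y, fun t ht => ?_⟩
  have h4 : Φ y ⟨t, ht⟩ = y ⟨t, ht⟩ := congrArg (fun w : C(Icc 0 N, X) => w ⟨t, ht⟩) hfix
  change Real.exp (ρ * t) • IccExtend hN y t = G y t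
  rw [IccExtend_of_mem _ _ ht, ← h4]
  simp only [Φ, ContinuousMap.coe_mk, smul_smul]
  rw [← Real.exp_add]
  simp

/-- Uniqueness makes the solutions on the intervals `[0, n]` agree, so they glue. -/
theorem exists_isMildSolution (hT : IsC0Semigroup T) (hf : ∀ q, LipschitzWith L (f q))
    (hf0 : ∀ q, f q (0, 0) = 0) (hσ : σ ∈ PC Q) {u : ℝ → U}
    (hu : ∀ N : ℝ, IntegrableOn u (Icc 0 N)) (x₀ : X) : ∃ x, IsMildSolution T f u x₀ σ x := by
  choose y hy using fun n : ℕ =>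
    exists_isMildSolutionOn hT hf hf0 hσ (Nat.cast_nonneg (α := ℝ) n) (hu n) x₀
  let x : ℝ → X := fun t => y ⌈t⌉₊ t
  have hxy : ∀ n : ℕ, EqOn x (y n) (Icc 0 n) := by
    intro n t ht
    have hle : (⌈t⌉₊ : ℝ) ≤ n := by exact_mod_cast Nat.ceil_le.2 ht.2
    exact (hy ⌈t⌉₊).eqOn hT hf hf0 hσ (hu _) (ae_eq_refl _) ((hy n).mono hle)
      ⟨ht.1, Nat.le_ceil t⟩
  have hxc : ContinuousOn x (Ici 0) := by
    intro t ht
    obtain ⟨n, hn⟩ := exists_nat_gt t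
    have h1 : ContinuousWithinAt x (Icc 0 n) t :=
      ((hy n).1.congr (hxy n)) t ⟨ht, hn.le⟩
    refine h1.mono_of_mem_nhdsWithin ?_
    filter_upwards [self_mem_nhdsWithin, mem_nhdsWithin_of_mem_nhds (Iio_mem_nhds hn)] with s h2 h3
    exact ⟨h2, le_of_lt h3⟩
  refine ⟨x, hxc, fun t ht => ?_⟩
  obtain ⟨n, hn⟩ := exists_nat_gt t
  refine ⟨hT.intervalIntegrable_apply (integrableOn_forcing hf hf0 hσ
    (hxc.mono Icc_subset_Ici_self) (hu t)) ⟨ht, le_rfl⟩, ?_⟩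
  rw [hxy n ⟨ht, hn.le⟩, (hy n).2 t ⟨ht, hn.le⟩]
  congr 1
  refine intervalIntegral.integral_congr fun s hs => ?_
  rw [uIcc_of_le ht] at hs
  simp only [hxy n ⟨hs.1, hs.2.trans hn.le⟩]

end System

/-! ### The delayed inequality and the gain -/

section Gain

variable {X U Q : Type*} [NormedAddCommGroup X] [NormedSpace ℝ X] [CompleteSpace X]
  [NormedAddCommGroup U]
  {T : ℝ → X →L[ℝ] X} {f : Q → X × U → X} {L : ℝ≥0} {σ : ℝ → Q}

theorem isMildSolution_trajectory (hT : IsC0Semigroup T) (hf : ∀ q, LipschitzWith L (f q))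
    (hf0 : ∀ q, f q (0, 0) = 0) (hσ : σ ∈ PC Q) {u : ℝ → U}
    (hu : ∀ N : ℝ, IntegrableOn u (Icc 0 N)) (x₀ : X) :
    IsMildSolution T f u x₀ σ (fun t => trajectory T f u t x₀ σ) := by
  have h := exists_isMildSolution hT hf hf0 hσ hu x₀
  have e : (fun t => trajectory T f u t x₀ σ) = h.choose := by
    funext t
    rw [trajectory, dif_pos h]
  rw [e]
  exact h.choose_spec

theorem integrableOn_translate {u : ℝ → U} (hu : ∀ N : ℝ, IntegrableOn u (Icc 0 N)) {a : ℝ}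
    (ha : 0 ≤ a) (N : ℝ) : IntegrableOn (fun s => u (a + s)) (Icc 0 N) := by
  have h1 : IntegrableOn u (Icc a (a + N)) :=
    (hu (a + N)).mono_set (Icc_subset_Icc_left ha)
  have h2 := ((measurePreserving_add_left volume a).integrableOn_comp_preimage
    (measurableEmbedding_addLeft a)).2 h1
  simpa [Function.comp_def, preimage_const_add_Icc] using h2

/-- Exponential decay of the unforced trajectories bounds the growth of a forced one. -/
theorem IsMildSolution.norm_add_le (hT : IsC0Semigroup T) (hf : ∀ q, LipschitzWith L (f q))
    (hf0 : ∀ q, f q (0, 0) = 0) (hσ : σ ∈ PC Q) {M lam : ℝ}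
    (hdecay : ∀ t : ℝ, 0 ≤ t → ∀ x : X, ∀ σ ∈ PC Q,
      ‖trajectory T f (fun _ : ℝ => (0 : U)) t x σ‖ ≤ M * Real.exp (-lam * t) * ‖x‖)
    {τ K : ℝ} (hK : 0 < K) (hTK : ∀ r ∈ Icc 0 τ, ‖T r‖ ≤ K) {u : ℝ → U}
    (hu : ∀ N : ℝ, IntegrableOn u (Icc 0 N)) {x₀ : X} {x : ℝ → X}
    (hx : IsMildSolution T f u x₀ σ x) {a N : ℝ} (ha : 0 ≤ a) (hN : 0 ≤ N) (hNτ : N ≤ τ) :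
    ‖x (a + N)‖ ≤ M * Real.exp (-lam * N) * ‖x a‖ +
      2 * (K * L) * Real.exp (2 * (K * L + 1) * τ) * ∫ s in Icc 0 N, ‖u (a + s)‖ := by
  -- The comparison trajectory is unforced, starts at `x a` and follows the shifted signal; the
  -- decay is available because it is uniform over `PC`.
  have hσ' := PC.shift hσ ha
  have h0 : ∀ N : ℝ, IntegrableOn (fun _ : ℝ => (0 : U)) (Icc 0 N) := fun N => integrableOn_zero
  have hy := isMildSolution_trajectory hT hf hf0 hσ' h0 (x a)
  have hxy := ((hx.shift hT ha).isMildSolutionOn N).norm_sub_le hT hf hf0 hσ' hK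
    (fun r hr => hTK r ⟨hr.1, hr.2.trans hNτ⟩) (integrableOn_translate hu ha N) (h0 N)
    (hy.isMildSolutionOn N) N ⟨hN, le_rfl⟩
  simp only [sub_zero] at hxy
  have h1 := hdecay N hN (x a) _ hσ'
  have hI : 0 ≤ ∫ s in Icc 0 N, ‖u (a + s)‖ := by positivity
  have h2 : 2 * (K * L * ∫ s in Icc 0 N, ‖u (a + s)‖) * Real.exp (2 * (K * L + 1) * N) ≤
      2 * (K * L * ∫ s in Icc 0 N, ‖u (a + s)‖) * Real.exp (2 * (K * L + 1) * τ) := by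
    gcongr
  have h3 := norm_le_norm_add_norm_sub' (x (a + N))
    (trajectory T f (fun _ : ℝ => (0 : U)) N (x a) fun t => σ (a + t))
  linarith

/-- Reflecting `s ↦ t - a - s` turns the forward window from `a` into a backward one from `t`. The
endpoint `s = 0` is a null set. -/
theorem setLIntegral_translate_le (u : ℝ → U) {t a τ : ℝ} (ha : 0 ≤ a) (hτ : t - a ≤ τ) :
    ∫⁻ s in Icc 0 (t - a), ‖u (a + s)‖ₑ ≤
      ∫⁻ s in Ioc 0 τ, (Ici 0).indicator (fun r => ‖u r‖ₑ) (t - s) := by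
  rw [← lintegral_indicator measurableSet_Icc, ← lintegral_indicator measurableSet_Ioc,
    ← lintegral_sub_left_eq_self _ (t - a)]
  refine lintegral_mono_ae ?_
  filter_upwards [compl_mem_ae_iff.2 (measure_singleton (0 : ℝ))] with s hs
  refine indicator_apply_le' (fun h => ?_) fun _ => zero_le
  have hs0 : 0 < s := lt_of_le_of_ne (by linarith [h.2]) (Ne.symm hs)
  rw [indicator_of_mem (show s ∈ Ioc 0 τ from ⟨hs0, by linarith [h.1]⟩),
    indicator_of_mem (show t - s ∈ Ici 0 from by simp only [mem_Ici]; linarith [h.1])]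
  ring_nf
  exact le_rfl

/-- The `L^p`-gain estimate for mild solutions starting at the origin. -/
theorem exists_gain (hT : IsC0Semigroup T) (hf : ∀ q, LipschitzWith L (f q))
    (hf0 : ∀ q, f q (0, 0) = 0) (hUGES : UGES (PC Q) (trajectory T f (fun _ : ℝ => (0 : U))))
    {p : ℝ≥0∞} (hp : 1 ≤ p) :
    ∃ c : ℝ≥0, 0 < c ∧ ∀ σ ∈ PC Q, ∀ u : ℝ → U,
      AEStronglyMeasurable u (volume.restrict (Ici 0)) → (∀ N : ℝ, IntegrableOn u (Icc 0 N)) →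
      ∀ x, IsMildSolution T f u 0 σ x →
        eLpNorm x p (volume.restrict (Ici 0)) ≤ c * eLpNorm u p (volume.restrict (Ici 0)) := by
  obtain ⟨M, hM, lam, hlam, hdecay⟩ := hUGES
  -- Then `exp (-lam * τ) = exp (-2M)`, and `2M ≤ exp (2M)` gives the factor `1/2`.
  set τ : ℝ := 2 * M / lam with hτ
  have hτ0 : 0 < τ := by positivity
  have hhalf : M * Real.exp (-lam * τ) ≤ 2⁻¹ := by
    have h1 : lam * τ = 2 * M := by rw [hτ]; field_simp
    have h2 : 2 * M ≤ Real.exp (2 * M) := by linarith [Real.add_one_le_exp (2 * M)]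
    rw [neg_mul, h1, Real.exp_neg, ← div_eq_mul_inv, div_le_iff₀ (Real.exp_pos _)]
    linarith
  obtain ⟨K, hK, hTK⟩ := hT.exists_norm_le τ
  set D : ℝ := 2 * (K * L) * Real.exp (2 * (K * L + 1) * τ) with hD
  have hD0 : 0 ≤ D := by positivity
  -- The `+ 1` only keeps the gain positive when `D = 0`.
  refine ⟨2 * (D.toNNReal * τ.toNNReal) + 1, by positivity, fun σ hσ u hum hu x hx => ?_⟩
  set h := (Ici 0).indicator x with hh
  set w : ℝ → ℝ≥0∞ := (Ici 0).indicator (fun r => ‖u r‖ₑ) with hw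
  have hx0 : x 0 = 0 := by simpa using (hx.2 0 le_rfl).2
  have hhm : AEStronglyMeasurable h volume :=
    (aestronglyMeasurable_indicator_iff measurableSet_Ici).2
      (hx.1.aestronglyMeasurable measurableSet_Ici)
  have hwm : AEMeasurable w volume :=
    (aemeasurable_indicator_iff measurableSet_Ici).2 hum.enorm
  have hbdd : ∀ R : ℝ, ∃ B : ℝ, ∀ t ≤ R, ‖h t‖ ≤ B := by
    intro R
    obtain ⟨B, hB⟩ := isCompact_Icc.exists_bound_of_continuousOn
      (hx.1.mono (t := Icc 0 R) Icc_subset_Ici_self)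
    refine ⟨max B 0, fun t ht => ?_⟩
    by_cases h0 : t ∈ Ici (0 : ℝ)
    · rw [hh, indicator_of_mem h0]
      exact (hB t ⟨h0, ht⟩).trans (le_max_left _ _)
    · rw [hh, indicator_of_notMem h0, norm_zero]
      exact le_max_right _ _
  have hle : ∀ t, 0 ≤ t →
      ‖h t‖ₑ ≤ 2⁻¹ * ‖h (t - τ)‖ₑ + D.toNNReal * ∫⁻ s in Ioc 0 τ, w (t - s) := by
    intro t ht
    -- Restart at `a = max (t - τ) 0`; for `t < τ` there is not enough time to decay, but `x 0 = 0`.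
    obtain ⟨a, ha, hat, haτ, hax⟩ : ∃ a : ℝ, 0 ≤ a ∧ a ≤ t ∧ t - a ≤ τ ∧
        M * Real.exp (-lam * (t - a)) * ‖x a‖ ≤ 2⁻¹ * ‖h (t - τ)‖ := by
      rcases le_or_gt τ t with htτ | htτ
      · refine ⟨t - τ, sub_nonneg.2 htτ, by linarith, by linarith, ?_⟩
        rw [hh, indicator_of_mem (show t - τ ∈ Ici 0 from sub_nonneg.2 htτ), sub_sub_cancel]
        gcongr
      · refine ⟨0, le_rfl, ht, by linarith, ?_⟩
        rw [hx0, norm_zero, mul_zero]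
        positivity
    have h1 := hx.norm_add_le hT hf hf0 hσ hdecay hK hTK hu ha (sub_nonneg.2 hat) haτ
    rw [add_sub_cancel] at h1
    have h2 : ENNReal.ofReal (∫ s in Icc 0 (t - a), ‖u (a + s)‖) ≤
        ∫⁻ s in Ioc 0 τ, w (t - s) := by
      rw [ofReal_integral_norm_eq_lintegral_enorm (integrableOn_translate hu ha _)]
      exact setLIntegral_translate_le u ha haτ
    rw [hh, indicator_of_mem (show t ∈ Ici 0 from ht), ← hh, ← ofReal_norm]
    calc ENNReal.ofReal ‖x t‖
        ≤ ENNReal.ofReal (2⁻¹ * ‖h (t - τ)‖ + D * ∫ s in Icc 0 (t - a), ‖u (a + s)‖) := by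
          apply ENNReal.ofReal_le_ofReal
          linarith
      _ = 2⁻¹ * ‖h (t - τ)‖ₑ + D.toNNReal * ENNReal.ofReal (∫ s in Icc 0 (t - a), ‖u (a + s)‖) := by
          rw [ENNReal.ofReal_add (by positivity) (by positivity), ENNReal.ofReal_mul (by norm_num),
            ENNReal.ofReal_mul hD0, ofReal_norm, ENNReal.ofReal_inv_of_pos (by norm_num)]
          simp [ENNReal.ofReal]
      _ ≤ _ := by gcongr
  have hfin := eLpNorm_le_of_delay_inequality hhm hwm
    (fun t ht => indicator_of_notMem (not_le.2 ht) x) hbdd hτ0.le D.toNNReal hp hle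
  have e1 : eLpNorm h p volume = eLpNorm x p (volume.restrict (Ici 0)) :=
    eLpNorm_indicator_eq_eLpNorm_restrict measurableSet_Ici
  have e2 : eLpNorm w p volume = eLpNorm u p (volume.restrict (Ici 0)) := by
    rw [hw, eLpNorm_indicator_eq_eLpNorm_restrict measurableSet_Ici, eLpNorm_enorm]
  rw [e1, e2] at hfin
  refine hfin.trans ?_
  calc 2 * (D.toNNReal * (ENNReal.ofReal τ * eLpNorm u p (volume.restrict (Ici 0))))
      = ((2 * (D.toNNReal * τ.toNNReal) : ℝ≥0) : ℝ≥0∞) * eLpNorm u p (volume.restrict (Ici 0)) := by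
        push_cast
        simp only [ENNReal.ofReal]
        ring
    _ ≤ _ := by
        gcongr
        exact le_add_of_nonneg_right zero_le_one

end Gain

theorem mainTheorem9 {X U Q : Type*}
    [NormedAddCommGroup X] [NormedSpace ℝ X] [CompleteSpace X]
    [NormedAddCommGroup U] [NormedSpace ℝ U] [CompleteSpace U]
    (A : X →ₗ.[ℝ] X) (T : ℝ → X →L[ℝ] X) (hT : IsC0Semigroup T)
    (hA : IsInfinitesimalGenerator A T)
    (f : Q → X × U → X) (L : ℝ≥0) (hf : ∀ q : Q, LipschitzWith L (f q))
    (hf0 : ∀ q : Q, f q (0, 0) = 0)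
    (hUGES : UGES (PC Q) (trajectory T f (fun _ : ℝ => (0 : U))))
    (p : ℝ≥0∞) (hp : 1 ≤ p) :
    ∃ c : ℝ≥0, 0 < c ∧
      ∀ σ ∈ PC Q, ∀ u : ℝ → U, MemLp u p (volume.restrict (Ici 0)) →
        -- `φ_u(·, 0, σ)` is the unique mild solution, and depends only on the class of `u` in `L^p`
        IsMildSolution T f u 0 σ (fun t => trajectory T f u t 0 σ) ∧
        (∀ y : ℝ → X, IsMildSolution T f u 0 σ y →
          EqOn y (fun t => trajectory T f u t 0 σ) (Ici 0)) ∧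
        (∀ v : ℝ → U, u =ᵐ[volume.restrict (Ici 0)] v →
          EqOn (fun t => trajectory T f u t 0 σ) (fun t => trajectory T f v t 0 σ) (Ici 0)) ∧
        -- it is in `L^p`, with gain at most `c`
        MemLp (fun t => trajectory T f u t 0 σ) p (volume.restrict (Ici 0)) ∧
        eLpNorm (fun t => trajectory T f u t 0 σ) p (volume.restrict (Ici 0)) ≤
          c * eLpNorm u p (volume.restrict (Ici 0)) := by
  have hloc : ∀ u : ℝ → U, MemLp u p (volume.restrict (Ici 0)) → ∀ N : ℝ,
      IntegrableOn u (Icc 0 N) := fun u hu N =>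
    (hu.mono_measure (Measure.restrict_mono_set volume Icc_subset_Ici_self)).integrable hp
  obtain ⟨c, hc, hgain⟩ := exists_gain hT hf hf0 hUGES hp
  refine ⟨c, hc, fun σ hσ u hu => ?_⟩
  have hsol := isMildSolution_trajectory hT hf hf0 hσ (hloc u hu) 0
  have hle := hgain σ hσ u hu.1 (hloc u hu) _ hsol
  refine ⟨hsol, fun y hy t ht => ?_, fun v hv t ht => ?_,
    ⟨hsol.1.aestronglyMeasurable measurableSet_Ici,
      hle.trans_lt (ENNReal.mul_lt_top ENNReal.coe_lt_top hu.2)⟩, hle⟩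
  · exact ((hsol.isMildSolutionOn t).eqOn hT hf hf0 hσ (hloc u hu t) (ae_eq_refl u)
      (hy.isMildSolutionOn t) ⟨ht, le_rfl⟩).symm
  · have hsol' := isMildSolution_trajectory hT hf hf0 hσ (hloc v (hu.ae_eq hv)) 0
    exact (hsol.isMildSolutionOn t).eqOn hT hf hf0 hσ (hloc u hu t)
      (ae_restrict_of_ae_restrict_of_subset Icc_subset_Ici_self hv)
      (hsol'.isMildSolutionOn t) ⟨ht, le_rfl⟩
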